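/- Work on a real RAM: registers hold real numbers, and each of the operations $+,-,\times,/,\lfloor\cdot\rfloor$, loading a rational constant, copying a register, and comparing two registers takes unit time. Let $P$ be a rectangular grid of $p\ge 1$ pixels aligned with the coordinate axes, that is, $$P=\{(x_0+i\,d_x,\;y_0+j\,d_y) : 0\le i<a,\ 0\le j<b\},\qquad d_x,d_y>0,\quad a,b\ge 1,\quad p=ab.$$ A gap $\gamma$ is the (possibly unbounded, possibly empty) triangle consisting of the points on or to the right of a vertical sweepline $x=\ell$, below a non-vertical line $y=m_1x+c_1$ (the line through the bottom edge of a trapezoid) and above a non-vertical line $y=m_2x+c_2$ (the line through the top edge of another trapezoid); either of the two edge lines may be absent, in which case the corresponding constraint is dropped. Fix either of the two conventions that points on the edge lines belong to the gap, or that they do not. Then there are a single program and a constant $C$ such that, for every such grid $P$ and every gap $\gamma$, given the numbers $a,b,x_0,y_0,d_x,d_y,\ell$ and the slopes and intercepts of the edge lines, the program halts after at most $C(1+\log p)$ steps (so in $O(\log p)$ time for $p\ge 2$) and either outputs the coordinates of a leftmost pixel in $\gamma$, that is, of a point of $P\cap\gamma$ with minimum $x$-coordinate, or correctly reports that $P\cap\gamma=\emptyset$.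 -/

import Mathlib

/-! ### The machine: a real RAM with unit-cost operations -/

namespace RealRAM

/-- The memory: countably many registers, each holding a real number. -/
abbrev Store := ℕ → ℝ

/-- The basic operations; `d` is the destination register. Constants are rational. Registers are
addressed directly only; a machine that also has indirect addressing runs the same programs. -/
inductive Op : Type
  | const (d : ℕ) (q : ℚ)
  | copy (d a : ℕ)
  | add (d a b : ℕ)
  | sub (d a b : ℕ)
  | mul (d a b : ℕ)
  | div (d a b : ℕ)
  | floor (d a : ℕ)

/-- Division by zero is the only operation that fails. -/
def Op.Defined : Op → Store → Prop
  | .div _ _ b, s => s b ≠ 0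
  | _, _ => True

/-- The effect of a basic operation on the memory. -/
noncomputable def Op.apply : Op → Store → Store
  | .const d q, s => Function.update s d (q : ℝ)
  | .copy d a, s => Function.update s d (s a)
  | .add d a b, s => Function.update s d (s a + s b)
  | .sub d a b, s => Function.update s d (s a - s b)
  | .mul d a b, s => Function.update s d (s a * s b)
  | .div d a b, s => Function.update s d (s a / s b)
  | .floor d a, s => Function.update s d ((⌊s a⌋ : ℤ) : ℝ)

/-- The basic tests: comparisons of two registers. -/
inductive Test : Type
  | lt (a b : ℕ)
  | le (a b : ℕ)
  | eq (a b : ℕ)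

/-- The comparison `c` succeeds on the memory `s`. -/
def Test.Holds : Test → Store → Prop
  | .lt a b, s => s a < s b
  | .le a b, s => s a ≤ s b
  | .eq a b, s => s a = s b

/-- Programs. -/
inductive Program : Type
  | skip
  | op (o : Op)
  | seq (c₁ c₂ : Program)
  | ite (b : Test) (c₁ c₂ : Program)
  | loop (b : Test) (c : Program)

/-- `Exec c s t s'`: started on the memory `s`, the program `c` halts after exactly `t` time steps
with memory `s'`. Every basic operation and every evaluation of a test takes one step. -/
inductive Exec : Program → Store → ℕ → Store → Prop
  | skip (s : Store) : Exec .skip s 1 s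
  | op (o : Op) (s : Store) (h : o.Defined s) : Exec (.op o) s 1 (o.apply s)
  | seq {c₁ c₂ : Program} {s s' s'' : Store} {t t' : ℕ}
      (h₁ : Exec c₁ s t s') (h₂ : Exec c₂ s' t' s'') : Exec (.seq c₁ c₂) s (t + t') s''
  | ite_true {b : Test} {c₁ c₂ : Program} {s s' : Store} {t : ℕ}
      (hb : b.Holds s) (h : Exec c₁ s t s') : Exec (.ite b c₁ c₂) s (t + 1) s'
  | ite_false {b : Test} {c₁ c₂ : Program} {s s' : Store} {t : ℕ}
      (hb : ¬ b.Holds s) (h : Exec c₂ s t s') : Exec (.ite b c₁ c₂) s (t + 1) s'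
  | loop_true {b : Test} {c : Program} {s s' s'' : Store} {t t' : ℕ}
      (hb : b.Holds s) (h₁ : Exec c s t s') (h₂ : Exec (.loop b c) s' t' s'') :
      Exec (.loop b c) s (t + t' + 1) s''
  | loop_false {b : Test} {c : Program} {s : Store}
      (hb : ¬ b.Holds s) : Exec (.loop b c) s 1 s

/-- Execution is deterministic, so the running time and the result are well defined. -/
theorem Exec.deterministic {c : Program} {s s₁ : Store} {t₁ : ℕ} (h : Exec c s t₁ s₁) :
    ∀ {t₂ : ℕ} {s₂ : Store}, Exec c s t₂ s₂ → t₁ = t₂ ∧ s₁ = s₂ := by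
  induction h with
  | skip s => intro t₂ s₂ h; cases h; exact ⟨rfl, rfl⟩
  | op o s hd => intro t₂ s₂ h; cases h; exact ⟨rfl, rfl⟩
  | seq _ _ ih₁ ih₂ =>
    intro t₂ s₂ h
    cases h with
    | seq k₁ k₂ =>
      obtain ⟨rfl, rfl⟩ := ih₁ k₁
      obtain ⟨rfl, rfl⟩ := ih₂ k₂
      exact ⟨rfl, rfl⟩
  | ite_true hb _ ih =>
    intro t₂ s₂ h
    cases h with
    | ite_true _ k => obtain ⟨rfl, rfl⟩ := ih k; exact ⟨rfl, rfl⟩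
    | ite_false hb' _ => exact absurd hb hb'
  | ite_false hb _ ih =>
    intro t₂ s₂ h
    cases h with
    | ite_true hb' _ => exact absurd hb' hb
    | ite_false _ k => obtain ⟨rfl, rfl⟩ := ih k; exact ⟨rfl, rfl⟩
  | loop_true hb _ _ ih₁ ih₂ =>
    intro t₂ s₂ h
    cases h with
    | loop_true _ k₁ k₂ =>
      obtain ⟨rfl, rfl⟩ := ih₁ k₁
      obtain ⟨rfl, rfl⟩ := ih₂ k₂
      exact ⟨rfl, rfl⟩
    | loop_false hb' => exact absurd hb hb'
  | loop_false hb =>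
    intro t₂ s₂ h
    cases h with
    | loop_true hb' _ _ => exact absurd hb' hb
    | loop_false _ => exact ⟨rfl, rfl⟩

end RealRAM

/-! ### Pixels and gaps -/

namespace PixelSweep

/-- A nonempty rectangular grid of pixels, aligned with the coordinate axes, with `cols` columns at
horizontal distance `dx` and `rows` rows at vertical distance `dy`; `(x₀, y₀)` is the lower left
pixel. -/
structure PixelGrid where
  cols : ℕ
  rows : ℕ
  cols_pos : 0 < cols
  rows_pos : 0 < rows
  x₀ : ℝ
  y₀ : ℝ
  dx : ℝ
  dy : ℝ
  dx_pos : 0 < dx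
  dy_pos : 0 < dy

/-- The set of pixels of the grid. -/
def PixelGrid.pixels (P : PixelGrid) : Set (ℝ × ℝ) :=
  {q | ∃ i j : ℕ, i < P.cols ∧ j < P.rows ∧ q = (P.x₀ + i * P.dx, P.y₀ + j * P.dy)}

/-- The number `p` of pixels. -/
def PixelGrid.size (P : PixelGrid) : ℕ := P.cols * P.rows

theorem PixelGrid.ncard_pixels (P : PixelGrid) : P.pixels.ncard = P.size := by
  have hinj : Function.Injective
      (fun ij : ℕ × ℕ => ((P.x₀ + ij.1 * P.dx, P.y₀ + ij.2 * P.dy) : ℝ × ℝ)) := by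
    rintro ⟨i, j⟩ ⟨i', j'⟩ h
    simpa [P.dx_pos.ne', P.dy_pos.ne'] using h
  have himg : P.pixels = (fun ij : ℕ × ℕ => ((P.x₀ + ij.1 * P.dx, P.y₀ + ij.2 * P.dy) : ℝ × ℝ)) ''
      (↑(Finset.range P.cols ×ˢ Finset.range P.rows) : Set (ℕ × ℕ)) := by
    ext q
    simp only [PixelGrid.pixels, Set.mem_ofPred_eq, Set.mem_image, Finset.mem_coe,
      Finset.mem_product, Finset.mem_range, Prod.exists]
    constructor
    · rintro ⟨i, j, hi, hj, rfl⟩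
      exact ⟨i, j, ⟨hi, hj⟩, rfl⟩
    · rintro ⟨i, j, ⟨hi, hj⟩, rfl⟩
      exact ⟨i, j, hi, hj, rfl⟩
  rw [himg, Set.ncard_image_of_injective _ hinj, Set.ncard_coe_finset]
  simp [PixelGrid.size]

/-- A non-vertical line `y = slope * x + intercept`. -/
structure Line where
  slope : ℝ
  intercept : ℝ

/-- The height of the line at the abscissa `x`. -/
def Line.height (e : Line) (x : ℝ) : ℝ := e.slope * x + e.intercept

/-- A gap: what lies to the right of the vertical sweepline `x = sweep`, below the line `upper`
through the bottom edge of a trapezoid, and above the line `lower` through the top edge of another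
trapezoid. If there is no trapezoid above (or below), the corresponding line is absent; in the gap
that contains the entire grid, before any trapezoid is found, both are. -/
structure Gap where
  sweep : ℝ
  upper : Option Line
  lower : Option Line

/-- The (possibly unbounded, possibly empty) triangle that is the gap. Points on the sweepline
belong to it; points on the two edge lines belong to it if and only if `edges = true`. -/
def Gap.region (γ : Gap) (edges : Bool) : Set (ℝ × ℝ) :=
  {q | γ.sweep ≤ q.1 ∧
    (∀ e ∈ γ.upper, if edges then q.2 ≤ e.height q.1 else q.2 < e.height q.1) ∧
    (∀ e ∈ γ.lower, if edges then e.height q.1 ≤ q.2 else e.height q.1 < q.2)}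

/-- `q` is a leftmost point of `A`. -/
def IsLeftmost (A : Set (ℝ × ℝ)) (q : ℝ × ℝ) : Prop :=
  q ∈ A ∧ ∀ r ∈ A, q.1 ≤ r.1

/-- A possibly absent line as three numbers: a flag, the slope and the intercept. -/
def encodeLine : Option Line → List ℝ
  | none => [0, 0, 0]
  | some e => [1, e.slope, e.intercept]

/-- The initial memory: the data of the grid and of the gap in registers `0` to `12`, and `0` in
every other register. -/
def input (P : PixelGrid) (γ : Gap) : RealRAM.Store := fun k =>
  ([(P.cols : ℝ), (P.rows : ℝ), P.x₀, P.y₀, P.dx, P.dy, γ.sweep]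
    ++ encodeLine γ.upper ++ encodeLine γ.lower).getD k 0

/-- The memory `s` holds a correct answer for the point set `A`: either register `0` holds `1` and
registers `1` and `2` hold the coordinates of a leftmost point of `A`, or register `0` holds `0` and
`A` is empty. -/
def Answers (s : RealRAM.Store) (A : Set (ℝ × ℝ)) : Prop :=
  (s 0 = 1 ∧ IsLeftmost A (s 1, s 2)) ∨ (s 0 = 0 ∧ A = ∅)

end PixelSweep

/-!
In pixel units the question is for the first column `i` in which some integer `j` lies between two
lines, `B * i + V` and `A * i + U`, and in the range of the rows. Both conventions for the edges are
treated at once: `Rel e` is the order relation of the convention, and `up e t` is the least integer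
above `t` in the sense of `Rel e`.

*Reduction to two lines.* The conditions `0 ≤ upper`, `lower ≤ rows - 1` and `lower ≤ upper` are
linear in the column. Those that increase with the column determine, together with the sweepline,
a start column `L`; the others need only be checked at the end, for the first column `i ≥ L` with an
integer between the lines: if they fail there, they fail in all later columns
(`check_of_inGap`, `isLeftmost_of_isLeast`).

*The search* for this column is a variant of Euclid's algorithm. Unless the column `x = 0` has an
integer between the lines, or the lines have crossed, a shift of `y` makes both lines cross that
column between `0` and `1`, and a shear `y - k * x`, which keeps the columns, makes `0 < A ≤ 1`. If
`1 ≤ B`, then no lattice point is left (`Frame.Normal.not_feas`); if `B ≤ 0`, then the leftmost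
point lies in row `0` or `1` (`Frame.Normal.lexMin`). If `0 < B < 1`, then all lattice points have
`1 ≤ y`, and the least abscissa in a row increases with the row. Hence the lowest row with a point
contains the leftmost point, and the axes may be exchanged, which inverts the slopes
(`Frame.Tracks.swap`). Shears and exchanges preserve lexicographic minimality, so that it suffices
to carry along the integers `p`, `q`, `r` for which the point `(x, y)` of the current frame has the
original abscissa `p * x + q * y + r`.

*Running time.* With `N` the last column of interest, the next round has only to look at rows up to
`A * N`, and `N * (1 + B)` decreases by the factor `2 / 3` in each round
(`Frame.next_potential`), while the search ends as soon as `N < 1`. Hence there are `O(log p)`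
rounds of a bounded number of steps.

Programs without loops are verified by weakest preconditions (`RealRAM.wp`).
-/

/-! ### Edges that belong to the gap, or not -/

namespace PixelSweep

/-- The order relation of the chosen convention: `≤` if edge points belong to the gap, `<` if they
do not. -/
def Rel (e : Bool) (a b : ℝ) : Prop := if e then a ≤ b else a < b

/-- The least integer above `t` in the sense of `Rel e`. -/
noncomputable def up (e : Bool) (t : ℝ) : ℤ := if e then ⌈t⌉ else ⌊t⌋ + 1

theorem up_le_iff {e : Bool} {t : ℝ} {z : ℤ} : up e t ≤ z ↔ Rel e t z := by
  cases e
  · simp [up, Rel, Int.floor_lt]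
  · simp [up, Rel, Int.ceil_le]

theorem rel_up (e : Bool) (t : ℝ) : Rel e t (up e t) := up_le_iff.1 le_rfl

theorem Rel.le {e : Bool} {a b : ℝ} (h : Rel e a b) : a ≤ b := by
  cases e
  · exact le_of_lt (by simpa [Rel] using h)
  · simpa [Rel] using h

theorem Rel.of_lt {e : Bool} {a b : ℝ} (h : a < b) : Rel e a b := by
  cases e
  · simpa [Rel] using h
  · simpa [Rel] using h.le

theorem le_of_not_rel {e : Bool} {a b : ℝ} (h : ¬ Rel e a b) : b ≤ a :=
  not_lt.1 fun h' => h (Rel.of_lt h')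

/-- `Rel e a b` depends only on `b - a`, and monotonically so. -/
theorem Rel.mono {e : Bool} {a b c d : ℝ} (h : Rel e a b) (hd : b - a ≤ d - c) : Rel e c d := by
  cases e
  · simp only [Rel, Bool.false_eq_true, if_false] at h ⊢; linarith
  · simp only [Rel, if_true] at h ⊢; linarith

/-- Scaling of an inequality by a positive factor. -/
theorem Rel.scale {e : Bool} {a b c d k : ℝ} (hk : 0 < k) (h : Rel e a b)
    (hd : d - c = k * (b - a)) : Rel e c d := by
  cases e
  · simp only [Rel, Bool.false_eq_true, if_false] at h ⊢
    have := mul_pos hk (sub_pos.2 h); linarith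
  · simp only [Rel, if_true] at h ⊢
    have := mul_nonneg hk.le (sub_nonneg.2 h); linarith

theorem rel_scale_iff {e : Bool} {a b c d k : ℝ} (hk : 0 < k) (hd : d - c = k * (b - a)) :
    Rel e a b ↔ Rel e c d :=
  ⟨fun h => h.scale hk hd, fun h => h.scale (inv_pos.2 hk) (by rw [hd]; field_simp)⟩

theorem rel_add_right {e : Bool} {a b : ℝ} (c : ℝ) : Rel e (a + c) (b + c) ↔ Rel e a b :=
  ⟨fun h => h.mono (by linarith), fun h => h.mono (by linarith)⟩

/-! ### Frames: the region between two lines, in changing coordinates -/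

/-- Two lines in a coordinate system of the integer lattice: `y = A * x + U` above and
`y = B * x + V` below. Only columns up to `N` are of interest. -/
structure Frame where
  A : ℝ
  U : ℝ
  B : ℝ
  V : ℝ
  N : ℝ

namespace Frame

/-- The lattice point `(x, y)` lies between the lines and has `0 ≤ x`. The bound `N` is not part of
the condition. -/
def Feas (e : Bool) (f : Frame) (x y : ℤ) : Prop :=
  0 ≤ x ∧ Rel e y (f.A * x + f.U) ∧ Rel e (f.B * x + f.V) y

/-- `(x, y)` is the lexicographically least lattice point between the lines. -/
def LexMin (e : Bool) (f : Frame) (x y : ℤ) : Prop :=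
  f.Feas e x y ∧ ∀ x' y', f.Feas e x' y' → x < x' ∨ (x = x' ∧ y ≤ y')

theorem lexMin_of_column {e : Bool} {f : Frame} {x : ℤ} (h : ∃ y, f.Feas e x y)
    (hmin : ∀ x' y', f.Feas e x' y' → x ≤ x') : f.LexMin e x (up e (f.B * x + f.V)) := by
  obtain ⟨y, h0, h1, h2⟩ := h
  refine ⟨⟨h0, ?_, rel_up _ _⟩, fun x' y' h' => ?_⟩
  · have : (up e (f.B * x + f.V) : ℝ) ≤ y := by exact_mod_cast up_le_iff.2 h2
    exact h1.mono (by linarith)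
  · rcases (hmin x' y' h').lt_or_eq with h | rfl
    · exact Or.inl h
    · exact Or.inr ⟨rfl, up_le_iff.2 h'.2.2⟩

/-- The frame `f` tracks the search for the least element of `G`: the point `(x, y)` of `f` stands
for the integer `p * x + q * y + r`, and if all points of `f` lie in columns beyond `f.N`, then all
elements of `G` are beyond `n`. -/
def Tracks (e : Bool) (G : Set ℤ) (n : ℝ) (f : Frame) (p q r : ℤ) : Prop :=
  (∀ x y, f.LexMin e x y → IsLeast G (p * x + q * y + r)) ∧
    ((∀ x y, f.Feas e x y → f.N < x) → ∀ i ∈ G, n < i)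

/-- The frame in the coordinates `(x, y - k * x)`. -/
def shear (f : Frame) (k : ℤ) : Frame := ⟨f.A - k, f.U, f.B - k, f.V, f.N⟩

/-- The frame in the coordinates `(x, y - m)`. -/
def shift (f : Frame) (m : ℤ) : Frame := ⟨f.A, f.U - m, f.B, f.V - m, f.N⟩

/-- The frame in the coordinates `(y - 1, x)`. The bound is the height of the upper line over the
column `f.N`. -/
noncomputable def swap (f : Frame) : Frame :=
  ⟨1 / f.B, (1 - f.V) / f.B, 1 / f.A, (1 - f.U) / f.A, f.A * f.N + f.U - 1⟩

theorem feas_shear {e : Bool} {f : Frame} {k x y : ℤ} :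
    (f.shear k).Feas e x y ↔ f.Feas e x (y + k * x) := by
  have h1 := rel_add_right (e := e) (a := y) (b := (f.A - k) * x + f.U) (k * x)
  have h2 := rel_add_right (e := e) (b := y) (a := (f.B - k) * x + f.V) (k * x)
  simp only [Feas, shear]
  rw [← h1, ← h2]
  push_cast
  ring_nf

theorem feas_shift {e : Bool} {f : Frame} {m x y : ℤ} :
    (f.shift m).Feas e x y ↔ f.Feas e x (y + m) := by
  have h1 := rel_add_right (e := e) (a := y) (b := f.A * x + (f.U - m)) m
  have h2 := rel_add_right (e := e) (b := y) (a := f.B * x + (f.V - m)) m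
  simp only [Feas, shift]
  rw [← h1, ← h2]
  push_cast
  ring_nf

theorem Tracks.shear {e : Bool} {G : Set ℤ} {n : ℝ} {f : Frame} {p q r : ℤ}
    (h : Tracks e G n f p q r) (k : ℤ) : Tracks e G n (f.shear k) (p + q * k) q r := by
  refine ⟨fun x y hxy => ?_, fun hN => h.2 fun x y hxy => ?_⟩
  · have := h.1 x (y + k * x) ⟨feas_shear.1 hxy.1, fun x' y' h' => ?_⟩
    · convert this using 1; ring
    · rcases hxy.2 x' (y' - k * x') (feas_shear.2 (by simpa using h')) with h | ⟨rfl, h⟩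
      · exact Or.inl h
      · exact Or.inr ⟨rfl, by linarith⟩
  · exact hN x (y - k * x) (feas_shear.2 (by simpa using hxy))

theorem Tracks.shift {e : Bool} {G : Set ℤ} {n : ℝ} {f : Frame} {p q r : ℤ}
    (h : Tracks e G n f p q r) (m : ℤ) : Tracks e G n (f.shift m) p q (r + q * m) := by
  refine ⟨fun x y hxy => ?_, fun hN => h.2 fun x y hxy => ?_⟩
  · have := h.1 x (y + m) ⟨feas_shift.1 hxy.1, fun x' y' h' => ?_⟩
    · convert this using 1; ring
    · rcases hxy.2 x' (y' - m) (feas_shift.2 (by simpa using h')) with h | ⟨rfl, h⟩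
      · exact Or.inl h
      · exact Or.inr ⟨rfl, by linarith⟩
  · exact hN x (y - m) (feas_shift.2 (by simpa using hxy))

/-- The situation of the column `x = 0` after a shift: both lines cross it between two consecutive
lattice points, of ordinates `0` and `1`, in the right order. -/
structure Normal (e : Bool) (f : Frame) : Prop where
  not_zero : ¬ Rel e f.V 0
  one : Rel e f.V 1
  not_one : ¬ Rel e 1 f.U
  le : f.V ≤ f.U

/-- If the column `x = 0` has no lattice point between the lines, then a shift normalizes it. -/
theorem normal_shift {e : Bool} {f : Frame} (h : ¬ Rel e (up e f.V) f.U) (hle : f.V ≤ f.U) :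
    (f.shift (up e f.V - 1)).Normal e := by
  refine ⟨fun h' => ?_, (rel_up e f.V).mono ?_, fun h' => h (h'.mono ?_), ?_⟩
  · have : up e f.V ≤ up e f.V - 1 := up_le_iff.2 (h'.mono (by simp [shift]))
    linarith
  all_goals simp only [shift]; push_cast; linarith

theorem Normal.one_le {e : Bool} {f : Frame} (hf : f.Normal e) (hB : 0 ≤ f.B) {x y : ℤ}
    (h : f.Feas e x y) : 1 ≤ y := by
  by_contra hy
  have hy' : (y : ℝ) ≤ 0 := by exact_mod_cast (by omega : y ≤ 0)
  have hx : (0 : ℝ) ≤ x := by exact_mod_cast h.1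
  exact hf.not_zero (h.2.2.mono (by nlinarith [mul_nonneg hB hx]))

theorem feas_swap {e : Bool} {f : Frame} (hA : 0 < f.A) (hB : 0 < f.B) {x y : ℤ} :
    f.swap.Feas e x y ↔
      0 ≤ x ∧ Rel e (x + 1) (f.A * y + f.U) ∧ Rel e (f.B * y + f.V) (x + 1) := by
  have h1 := rel_scale_iff (e := e) (a := 1 / f.A * x + (1 - f.U) / f.A) (b := y)
    (c := x + 1) (d := f.A * y + f.U) hA (by field_simp; ring)
  have h2 := rel_scale_iff (e := e) (b := 1 / f.B * x + (1 - f.V) / f.B) (a := y)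
    (d := x + 1) (c := f.B * y + f.V) hB (by field_simp; ring)
  simp only [Feas, swap]
  rw [h1, h2]
  tauto

/-- If both slopes are positive, then all points between the lines have `1 ≤ y`, and the least
abscissa in a row grows with the row. Hence the least row has the leftmost point. -/
theorem Tracks.swap {e : Bool} {G : Set ℤ} {n : ℝ} {f : Frame} {p q r : ℤ}
    (h : Tracks e G n f p q r) (hf : f.Normal e) (hA : 0 < f.A) (hB : 0 < f.B) :
    Tracks e G n f.swap q p (r + q) := by
  have hU : f.U ≤ 1 := le_of_not_rel hf.not_one
  have key : ∀ x y, f.Feas e x y → f.swap.Feas e (y - 1) x := fun x y hxy =>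
    (feas_swap hA hB).2 ⟨by linarith [hf.one_le hB.le hxy],
      by simpa using hxy.2.1, by simpa using hxy.2.2⟩
  refine ⟨fun x y hxy => ?_, fun hN => h.2 fun x y hxy => ?_⟩
  · obtain ⟨h0, h1, h2⟩ := (feas_swap hA hB).1 hxy.1
    have hx0 : (0 : ℝ) ≤ x := by exact_mod_cast h0
    have hy : 0 ≤ y := by
      by_contra hy
      have hy' : (y : ℝ) ≤ 0 := by exact_mod_cast (by omega : y ≤ 0)
      exact hf.not_one (h1.mono (by nlinarith))
    have := h.1 y (x + 1) ⟨⟨hy, by simpa using h1, by simpa using h2⟩, fun x' y' h' => ?_⟩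
    · convert this using 1; ring
    · have hk := key x' y' h'
      have hle : x + 1 ≤ y' := by
        rcases hxy.2 _ _ hk with h | ⟨h, -⟩ <;> linarith
      have hle' : ((x : ℝ) + 1) ≤ y' := by exact_mod_cast hle
      suffices hyx : y ≤ x' by
        rcases hyx.lt_or_eq with h | h
        · exact Or.inl h
        · exact Or.inr ⟨h, hle⟩
      -- Otherwise `x'` would be a smaller abscissa in the row of `(y, x + 1)`.
      by_contra hlt
      have hlt' : (x' : ℝ) ≤ y := by exact_mod_cast (by omega : x' ≤ y)
      have hs : f.swap.Feas e x x' := (feas_swap hA hB).2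
        ⟨h0, h'.2.1.mono (by linarith), h2.mono (by nlinarith)⟩
      rcases hxy.2 _ _ hs with h | ⟨-, h⟩
      · exact lt_irrefl _ h
      · exact hlt h
  · have hn := hN _ _ (key x y hxy)
    simp only [Frame.swap] at hn
    push_cast at hn
    have := hxy.2.1.le
    by_contra hx
    nlinarith [not_lt.1 hx]

/-! ### The cases in which the search ends -/

theorem lexMin_zero {e : Bool} {f : Frame} (h : Rel e (up e f.V) f.U) :
    f.LexMin e 0 (up e (f.B * (0 : ℤ) + f.V)) :=
  lexMin_of_column ⟨up e f.V, le_rfl, by simpa using h, by simpa using rel_up e f.V⟩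
    fun _ _ h => h.1

theorem lt_of_not_rel_up {e : Bool} {f : Frame} (h : ¬ Rel e (up e f.V) f.U) (hN : f.N < 1)
    {x y : ℤ} (hxy : f.Feas e x y) : f.N < x := by
  rcases hxy.1.lt_or_eq with hx | rfl
  · have : (1 : ℝ) ≤ x := by exact_mod_cast hx
    linarith
  · have h1 := hxy.2.1
    have h2 := up_le_iff.2 hxy.2.2
    simp only [Int.cast_zero, mul_zero, zero_add] at h1 h2
    have : (up e f.V : ℝ) ≤ y := by exact_mod_cast h2
    exact absurd (h1.mono (by linarith)) h

theorem not_feas_of_lt {e : Bool} {f : Frame} (h : f.B < f.A → f.V ≤ f.U) (hlt : f.U < f.V)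
    (x y : ℤ) : ¬ f.Feas e x y := by
  intro hxy
  have hAB : f.A ≤ f.B := not_lt.1 fun h' => absurd (h h') (not_le.2 hlt)
  have hx : (0 : ℝ) ≤ x := by exact_mod_cast hxy.1
  nlinarith [hxy.2.1.le, hxy.2.2.le, mul_le_mul_of_nonneg_right hAB hx]

/-- If the slopes are separated by `1` and the lines converge, then the region between them lies
between the lines of slope `1` through the points `(0, 0)` and `(0, 1)`. -/
theorem Normal.not_feas {e : Bool} {f : Frame} (hf : f.Normal e) (hA : f.A ≤ 1) (hB : 1 ≤ f.B)
    (x y : ℤ) : ¬ f.Feas e x y := by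
  intro hxy
  have hx : (0 : ℝ) ≤ x := by exact_mod_cast hxy.1
  rcases le_or_gt y x with h | h
  · have h' : (y : ℝ) ≤ x := by exact_mod_cast h
    exact hf.not_zero (hxy.2.2.mono (by nlinarith))
  · have h' : (x : ℝ) + 1 ≤ y := by exact_mod_cast h
    exact hf.not_one (hxy.2.1.mono (by nlinarith))

/-- If the lines diverge and their slopes are separated by `0`, then the leftmost points of the
region lie in the rows `0` and `1`. -/
theorem Normal.lexMin {e : Bool} {f : Frame} (hf : f.Normal e) (hA : 0 < f.A) (hB : f.B ≤ 0)
    {x : ℤ}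
    (hx : x = if f.B < 0 then min (up e (f.V / -f.B)) (up e ((1 - f.U) / f.A))
      else up e ((1 - f.U) / f.A)) :
    f.LexMin e x (up e (f.B * x + f.V)) := by
  have hU : f.U ≤ 1 := le_of_not_rel hf.not_one
  have hV : 0 ≤ f.V := le_of_not_rel hf.not_zero
  set x₀ := up e (f.V / -f.B) with hx₀
  set x₁ := up e ((1 - f.U) / f.A) with hx₁
  have row1 : ∀ z : ℤ, x₁ ≤ z ↔ Rel e 1 (f.A * z + f.U) := fun z => by
    rw [hx₁, up_le_iff]
    exact rel_scale_iff hA (by field_simp; ring)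
  have row0 : f.B < 0 → ∀ z : ℤ, x₀ ≤ z ↔ Rel e (f.B * z + f.V) 0 := fun hB' z => by
    rw [hx₀, up_le_iff]
    exact rel_scale_iff (neg_pos.2 hB') (by field_simp [hB'.ne]; ring)
  have hx₁0 : (0 : ℝ) ≤ x₁ := (div_nonneg (by linarith) hA.le).trans (rel_up e _).le
  have feas1 : f.Feas e x₁ 1 :=
    ⟨by exact_mod_cast hx₁0, by simpa using (row1 x₁).1 le_rfl,
      by simpa using hf.one.mono (by nlinarith)⟩
  have feas0 : f.B < 0 → f.Feas e x₀ 0 := fun hB' => by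
    have hx₀0 : (0 : ℝ) ≤ x₀ := (div_nonneg hV (by linarith)).trans (rel_up e _).le
    have hr := (row0 hB' x₀).1 le_rfl
    refine ⟨by exact_mod_cast hx₀0, ?_, by simpa using hr⟩
    rcases hx₀0.lt_or_eq with h | h
    · have := mul_pos hA h
      exact Rel.of_lt (by push_cast; linarith [hf.le])
    · exact absurd (by simpa [← h] using hr) hf.not_zero
  have low : ∀ x' y', f.Feas e x' y' → x₁ ≤ x' ∨ (f.B < 0 ∧ x₀ ≤ x') := fun x' y' h' => by
    rcases le_or_gt 1 y' with h | h
    · have h1 : (1 : ℝ) ≤ y' := by exact_mod_cast h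
      exact Or.inl ((row1 x').2 (h'.2.1.mono (by linarith)))
    · have h0 : (y' : ℝ) ≤ 0 := by exact_mod_cast (by omega : y' ≤ 0)
      have hr : Rel e (f.B * x' + f.V) 0 := h'.2.2.mono (by linarith)
      rcases hB.lt_or_eq with hB' | hB'
      · exact Or.inr ⟨hB', (row0 hB' x').2 hr⟩
      · exact absurd (by simpa [hB'] using hr) hf.not_zero
  apply lexMin_of_column
  · rw [hx]
    split_ifs with hB'
    · rcases min_choice x₀ x₁ with h | h <;> rw [h]
      exacts [⟨0, feas0 hB'⟩, ⟨1, feas1⟩]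
    · exact ⟨1, feas1⟩
  · intro x' y' h'
    rw [hx]
    rcases low x' y' h' with h | ⟨hB', h⟩
    · split_ifs
      exacts [(min_le_right _ _).trans h, h]
    · rw [if_pos hB']
      exact (min_le_left _ _).trans h

/-! ### The rounds of the search -/

/-- The invariant of the search: the frame tracks it, the upper slope is reduced, and diverging
lines are in the right order. -/
structure Inv (e : Bool) (G : Set ℤ) (n : ℝ) (f : Frame) (p q r : ℤ) : Prop where
  tracks : Tracks e G n f p q r
  pos : 0 < f.A
  le_one : f.A ≤ 1
  le : f.B < f.A → f.V ≤ f.U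

/-- The frame after one round of the search. -/
noncomputable def next (f : Frame) : Frame := f.swap.shear (⌈f.swap.A⌉ - 1)

theorem reduced (a : ℝ) : 0 < a - (⌈a⌉ - 1 : ℤ) ∧ a - (⌈a⌉ - 1 : ℤ) ≤ 1 := by
  push_cast
  constructor <;> linarith [Int.ceil_lt_add_one a, Int.le_ceil a]

theorem Inv.shift {e : Bool} {G : Set ℤ} {n : ℝ} {f : Frame} {p q r : ℤ}
    (h : Inv e G n f p q r) (m : ℤ) : Inv e G n (f.shift m) p q (r + q * m) :=
  ⟨h.tracks.shift m, h.pos, h.le_one, fun h' => sub_le_sub_right (h.le h') _⟩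

theorem Inv.next {e : Bool} {G : Set ℤ} {n : ℝ} {f : Frame} {p q r : ℤ}
    (h : Inv e G n f p q r) (hf : f.Normal e) (hB : 0 < f.B) :
    Inv e G n f.next (q + p * (⌈1 / f.B⌉ - 1)) p (r + q) := by
  have hr := reduced f.swap.A
  refine ⟨(h.tracks.swap hf h.pos hB).shear _, hr.1, hr.2, fun h' => ?_⟩
  have hA := h.pos
  have hlt : 1 / f.A < 1 / f.B := by
    have := h'; simp only [Frame.next, Frame.shear, Frame.swap] at this; linarith
  have hU : f.U ≤ 1 := le_of_not_rel hf.not_one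
  change (1 - f.U) / f.A ≤ (1 - f.V) / f.B
  have h1 : (1 - f.U) * (1 / f.A) ≤ (1 - f.V) * (1 / f.B) :=
    mul_le_mul (by linarith [hf.le]) hlt.le (by positivity) (by linarith [hf.le])
  simpa [div_eq_mul_inv] using h1

/-- The quantity `N * (1 + B)` falls by a third from one round to the next. With
`k = ⌈1 / B⌉ - 1` and `β` the new lower slope, `A = 1 / (k + β)` and `1 / (k + 1) ≤ B`, so this
comes down to `3 (1 + β) (k + 1) ≤ 2 (k + 2) (k + β)`, which holds for `1 ≤ k` and `β ≤ 1`. -/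
theorem next_potential {e : Bool} {f : Frame} (hf : f.Normal e) (hB : 0 < f.B)
    (hB1 : f.B < 1) (hN : 0 ≤ f.N) (h0 : 0 < f.next.B) (h1 : f.next.B < 1) :
    f.next.N * (1 + f.next.B) ≤ 2 / 3 * (f.N * (1 + f.B)) := by
  have hU : f.U ≤ 1 := le_of_not_rel hf.not_one
  set β := f.next.B with hβ
  set k : ℤ := ⌈1 / f.B⌉ - 1 with hk
  have hβk : 1 / f.A = k + β := by
    simp only [hβ, Frame.next, Frame.shear, Frame.swap, hk]; ring
  have hk1 : (1 : ℝ) ≤ k := by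
    have : 1 < ⌈1 / f.B⌉ := Int.lt_ceil.2 (by rw [lt_div_iff₀ hB]; simpa using hB1)
    exact_mod_cast (by omega : 1 ≤ k)
  have hBk : 1 / (k + 1 : ℝ) ≤ f.B := by
    have : 1 / f.B ≤ (k + 1 : ℝ) := by
      have := Int.le_ceil (1 / f.B); rw [hk]; push_cast; linarith
    rw [div_le_iff₀ (by linarith)]
    rwa [div_le_iff₀ hB, mul_comm] at this
  have hAk : f.A = 1 / (k + β) := by rw [← hβk]; simp
  have hNN : f.next.N ≤ f.A * f.N := by
    simp only [Frame.next, Frame.shear, Frame.swap]; linarith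
  have hmain : f.A * (1 + β) ≤ 2 / 3 * (1 + f.B) := by
    calc f.A * (1 + β) = (1 + β) / (k + β) := by rw [hAk]; ring
      _ ≤ 2 / 3 * (1 + 1 / (k + 1 : ℝ)) := by
          rw [div_le_iff₀ (by linarith)]
          have : 0 ≤ ((k : ℝ) - 1) * (2 * k + 3 - β) :=
            mul_nonneg (by linarith) (by linarith)
          have hk' : (0 : ℝ) < k + 1 := by linarith
          have e1 : 2 / 3 * (1 + 1 / (k + 1 : ℝ)) * (k + β)
              = 2 * (k + 2) * (k + β) / (3 * (k + 1)) := by field_simp; ring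
          rw [e1, le_div_iff₀ (by linarith)]
          nlinarith
      _ ≤ _ := by linarith
  calc f.next.N * (1 + β) ≤ f.A * f.N * (1 + β) :=
        mul_le_mul_of_nonneg_right hNN (by linarith)
    _ = f.N * (f.A * (1 + β)) := by ring
    _ ≤ f.N * (2 / 3 * (1 + f.B)) := mul_le_mul_of_nonneg_left hmain hN
    _ = _ := by ring

end Frame

end PixelSweep

/-! ### Reasoning about programs -/

namespace RealRAM

/-- Weakest precondition of a program without loops; `False` for a loop. -/
def wp : Program → (Store → Prop) → Store → Prop
  | .skip, Q, s => Q s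
  | .op o, Q, s => o.Defined s ∧ Q (o.apply s)
  | .seq c₁ c₂, Q, s => wp c₁ (wp c₂ Q) s
  | .ite b c₁ c₂, Q, s => (b.Holds s → wp c₁ Q s) ∧ (¬ b.Holds s → wp c₂ Q s)
  | .loop _ _, _, _ => False

/-- A bound for the running time of a program without loops. -/
def cost : Program → ℕ
  | .skip => 1
  | .op _ => 1
  | .seq c₁ c₂ => cost c₁ + cost c₂
  | .ite _ c₁ c₂ => cost c₁ + cost c₂ + 1
  | .loop _ _ => 0

theorem wp_sound : ∀ (c : Program) {Q : Store → Prop} {s : Store}, wp c Q s →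
    ∃ t s', Exec c s t s' ∧ t ≤ cost c ∧ Q s'
  | .skip, _, s, h => ⟨1, s, .skip s, le_rfl, h⟩
  | .op o, _, s, h => ⟨1, _, .op o s h.1, le_rfl, h.2⟩
  | .seq c₁ c₂, _, s, h => by
    obtain ⟨t₁, s₁, e₁, ht₁, h₁⟩ := wp_sound c₁ h
    obtain ⟨t₂, s₂, e₂, ht₂, h₂⟩ := wp_sound c₂ h₁
    exact ⟨_, s₂, .seq e₁ e₂, Nat.add_le_add ht₁ ht₂, h₂⟩
  | .ite b c₁ c₂, _, s, h => by
    by_cases hb : b.Holds s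
    · obtain ⟨t, s', e, ht, h'⟩ := wp_sound c₁ (h.1 hb)
      exact ⟨_, s', .ite_true hb e, by simp only [cost]; omega, h'⟩
    · obtain ⟨t, s', e, ht, h'⟩ := wp_sound c₂ (h.2 hb)
      exact ⟨_, s', .ite_false hb e, by simp only [cost]; omega, h'⟩
  | .loop _ _, _, _, h => h.elim

theorem wp_mono : ∀ (c : Program) {Q R : Store → Prop} {s : Store}, wp c Q s →
    (∀ s', Q s' → R s') → wp c R s
  | .skip, _, _, _, h, hQ => hQ _ h
  | .op _, _, _, _, h, hQ => ⟨h.1, hQ _ h.2⟩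
  | .seq c₁ c₂, _, _, _, h, hQ => wp_mono c₁ h fun _ h' => wp_mono c₂ h' hQ
  | .ite _ c₁ c₂, _, _, _, h, hQ =>
    ⟨fun hb => wp_mono c₁ (h.1 hb) hQ, fun hb => wp_mono c₂ (h.2 hb) hQ⟩
  | .loop _ _, _, _, _, h, _ => h

theorem wp_seq {c₁ c₂ : Program} {Q R : Store → Prop} {s : Store} (h : wp c₁ Q s)
    (hQ : ∀ s', Q s' → wp c₂ R s') : wp (.seq c₁ c₂) R s :=
  wp_mono c₁ h hQ

/-- The register that receives the result. -/
def Op.dest : Op → ℕ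
  | .const d _ | .copy d _ | .add d _ _ | .sub d _ _ | .mul d _ _ | .div d _ _ | .floor d _ => d

/-- All registers that the program may write are among those from `n` on. -/
def WritesFrom (n : ℕ) : Program → Prop
  | .skip => True
  | .op o => n ≤ o.dest
  | .seq c₁ c₂ => WritesFrom n c₁ ∧ WritesFrom n c₂
  | .ite _ c₁ c₂ => WritesFrom n c₁ ∧ WritesFrom n c₂
  | .loop _ c => WritesFrom n c

theorem WritesFrom.keeps {n : ℕ} {c : Program} {s s' : Store} {t : ℕ} (h : Exec c s t s')
    (hc : WritesFrom n c) {k : ℕ} (hk : k < n) : s' k = s k := by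
  induction h with
  | skip s => rfl
  | op o s _ =>
    cases o <;> exact Function.update_of_ne (Nat.ne_of_lt (hk.trans_le hc)) _ _
  | seq _ _ ih₁ ih₂ => exact (ih₂ hc.2).trans (ih₁ hc.1)
  | ite_true _ _ ih => exact ih hc.1
  | ite_false _ _ ih => exact ih hc.2
  | loop_true _ _ _ ih₁ ih₂ => exact (ih₂ hc).trans (ih₁ hc)
  | loop_false _ => rfl

theorem wp_keeps {n : ℕ} : ∀ (c : Program) {Q : Store → Prop} {s : Store}, WritesFrom n c →
    wp c Q s → wp c (fun s' => Q s' ∧ ∀ k < n, s' k = s k) s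
  | .skip, _, _, _, h => ⟨h, fun _ _ => rfl⟩
  | .op o, _, s, hc, h => ⟨h.1, h.2, fun k hk => by
      cases o <;> exact Function.update_of_ne (Nat.ne_of_lt (hk.trans_le hc)) _ _⟩
  | .seq c₁ c₂, _, _, hc, h => wp_mono c₁ (wp_keeps c₁ hc.1 h) fun _ h₁ =>
      wp_mono c₂ (wp_keeps c₂ hc.2 h₁.1) fun _ h₂ =>
        ⟨h₂.1, fun k hk => (h₂.2 k hk).trans (h₁.2 k hk)⟩
  | .ite _ c₁ c₂, _, _, hc, h =>
      ⟨fun hb => wp_keeps c₁ hc.1 (h.1 hb), fun hb => wp_keeps c₂ hc.2 (h.2 hb)⟩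
  | .loop _ _, _, _, _, h => h

/-- Consecutive basic operations. -/
def block : List Op → Program
  | [] => .skip
  | o :: l => .seq (.op o) (block l)

end RealRAM

namespace PixelSweep

open RealRAM

/-! ### The program of the search

Register `13` holds `0`, register `14` holds `1`. Registers `20` to `24` hold a frame, registers
`25` to `27` the coefficients `p`, `q`, `r` of the tracking. Register `28` is `0` as long as the
search is running, `1` if it has succeeded with the result in register `29`, and `2` if it has
failed. Registers from `30` on are for intermediate results. -/

/-- The frame in the memory. -/
def frameOf (s : Store) : Frame := ⟨s 20, s 21, s 22, s 23, s 24⟩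

/-- The constants, the coefficients of the tracking and the state of a running search. -/
def Running (s : Store) (p q r : ℤ) : Prop :=
  s 13 = 0 ∧ s 14 = 1 ∧ s 25 = p ∧ s 26 = q ∧ s 27 = r ∧ s 28 = 0

/-- The search for the least element of `G` up to `n` is over. -/
def Finished (G : Set ℤ) (n : ℝ) (s : Store) : Prop :=
  (s 28 = 1 ∧ ∃ i : ℤ, s 29 = i ∧ IsLeast G i) ∨ (s 28 = 2 ∧ ∀ i ∈ G, n < i)

/-- `d := up e a`. -/
def upProg (e : Bool) (d a : ℕ) : Program :=
  if e then block [.sub d 13 a, .floor d d, .sub d 13 d] else block [.floor d a, .add d d 14]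

theorem wp_upProg {e : Bool} {d a : ℕ} {Q : Store → Prop} {s : Store} (h0 : s 13 = 0)
    (h1 : s 14 = 1) (hd : 15 ≤ d) :
    wp (upProg e d a) Q s ↔ Q (Function.update s d (up e (s a) : ℝ)) := by
  have h13 : (13 : ℕ) ≠ d := by omega
  have h14 : (14 : ℕ) ≠ d := by omega
  cases e <;>
    simp [upProg, block, wp, Op.Defined, Op.apply, up, h0, h1, h13, h14, Int.floor_neg]

/-- The test whether `Rel e` holds between two registers. -/
def relTest (e : Bool) (a b : ℕ) : Test := if e then .le a b else .lt a b

theorem holds_relTest {e : Bool} {a b : ℕ} {s : Store} :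
    (relTest e a b).Holds s ↔ Rel e (s a) (s b) := by
  cases e <;> simp [relTest, Test.Holds, Rel]

/-- Subtracts `⌈A⌉ - 1` from the slopes. -/
def shearProg : Program :=
  block [.sub 30 13 20, .floor 30 30, .sub 30 13 30, .sub 30 30 14, .sub 20 20 30, .sub 22 22 30,
    .mul 31 26 30, .add 25 25 31]

theorem wp_shearProg {s : Store} {p q r : ℤ} (h : Running s p q r) :
    wp shearProg (fun s' => Running s' (p + q * (⌈s 20⌉ - 1)) q r ∧
      frameOf s' = (frameOf s).shear (⌈s 20⌉ - 1)) s := by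
  obtain ⟨h13, h14, h25, h26, h27, h28⟩ := h
  simp [shearProg, block, wp, Op.Defined, Op.apply, Running, frameOf, Frame.shear,
    h13, h14, h25, h26, h27, h28, Int.floor_neg]

/-- Subtracts `c - 1` from the intercepts, where register `30` holds `c`. -/
def shiftProg : Program :=
  block [.sub 30 30 14, .sub 21 21 30, .sub 23 23 30, .mul 31 26 30, .add 27 27 31]

theorem wp_shiftProg {s : Store} {p q r c : ℤ} (h : Running s p q r) (hc : s 30 = c) :
    wp shiftProg (fun s' => Running s' p q (r + q * (c - 1)) ∧
      frameOf s' = (frameOf s).shift (c - 1)) s := by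
  obtain ⟨h13, h14, h25, h26, h27, h28⟩ := h
  simp [shiftProg, block, wp, Op.Defined, Op.apply, Running, frameOf, Frame.shift,
    h13, h14, h25, h26, h27, h28, hc]

/-- Exchanges the axes. -/
def swapProg : Program :=
  block [.mul 30 20 24, .add 30 30 21, .sub 24 30 14,
    .div 30 14 22, .sub 31 14 23, .div 31 31 22,
    .div 32 14 20, .sub 33 14 21, .div 33 33 20,
    .copy 20 30, .copy 21 31, .copy 22 32, .copy 23 33,
    .copy 30 25, .copy 25 26, .copy 26 30, .add 27 27 25]

theorem wp_swapProg {s : Store} {p q r : ℤ} (h : Running s p q r) (hA : s 20 ≠ 0)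
    (hB : s 22 ≠ 0) :
    wp swapProg (fun s' => Running s' q p (r + q) ∧ frameOf s' = (frameOf s).swap) s := by
  obtain ⟨h13, h14, h25, h26, h27, h28⟩ := h
  simp [swapProg, block, wp, Op.Defined, Op.apply, Running, frameOf, Frame.swap,
    h13, h14, h25, h26, h27, h28, hA, hB]

/-- Ends the search successfully, with register `31` holding the least abscissa in the frame. -/
def foundProg (e : Bool) : Program :=
  .seq (block [.mul 32 22 31, .add 32 32 23]) (.seq (upProg e 32 32)
    (block [.mul 33 25 31, .mul 32 26 32, .add 29 33 32, .add 29 29 27, .copy 28 14]))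

theorem wp_foundProg {e : Bool} {G : Set ℤ} {n : ℝ} {s : Store} {p q r x : ℤ}
    (h : Running s p q r) (ht : (frameOf s).Tracks e G n p q r) (hx : s 31 = x)
    (hmin : (frameOf s).LexMin e x (up e ((frameOf s).B * x + (frameOf s).V))) :
    wp (foundProg e) (Finished G n) s := by
  have hl := ht.1 _ _ hmin
  obtain ⟨h13, h14, h25, h26, h27, h28⟩ := h
  simp only [foundProg, block, wp, Op.Defined, Op.apply, true_and]
  rw [wp_upProg (by simpa using h13)
    (by simpa using h14) (by norm_num)]
  refine Or.inl ⟨by simp [h14], _, ?_, hl⟩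
  simp [h25, h26, h27, hx, frameOf]

/-- Ends the search unsuccessfully. -/
def failProg : Program := .op (.const 28 2)

theorem wp_failProg {e : Bool} {G : Set ℤ} {n : ℝ} {s : Store} {p q r : ℤ}
    (ht : (frameOf s).Tracks e G n p q r)
    (h : ∀ x y, (frameOf s).Feas e x y → (frameOf s).N < x) : wp failProg (Finished G n) s :=
  ⟨trivial, Or.inr ⟨by simp [Op.apply], ht.2 h⟩⟩

/-- Puts the least abscissa of a lattice point in row `0` or `1` into register `31`. -/
def columnProg (e : Bool) : Program :=
  .seq (block [.sub 31 14 21, .div 31 31 20]) (.seq (upProg e 31 31)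
    (.ite (.lt 22 13)
      (.seq (block [.sub 32 13 22, .div 32 23 32]) (.seq (upProg e 32 32)
        (.ite (.lt 32 31) (.op (.copy 31 32)) .skip)))
      .skip))

theorem wp_columnProg {e : Bool} {s : Store} {p q r : ℤ} (h : Running s p q r) (hA : s 20 ≠ 0) :
    wp (columnProg e) (fun s' => Running s' p q r ∧ frameOf s' = frameOf s ∧
      s' 31 = ((if s 22 < 0 then min (up e (s 23 / -s 22)) (up e ((1 - s 21) / s 20))
        else up e ((1 - s 21) / s 20) : ℤ) : ℝ)) s := by
  obtain ⟨h13, h14, h25, h26, h27, h28⟩ := h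
  simp only [columnProg, block, wp, Op.Defined, Op.apply, true_and]
  refine ⟨by simpa using hA, ?_⟩
  rw [wp_upProg (by simpa using h13)
    (by simpa using h14) (by norm_num)]
  refine ⟨fun hB => ?_, fun hB => ?_⟩
  · have hB' : s 22 < 0 := by simpa [Test.Holds, h13] using hB
    refine ⟨by simpa [h13] using hB'.ne, ?_⟩
    rw [wp_upProg (by simpa using h13)
      (by simpa using h14) (by norm_num)]
    refine ⟨fun hlt => ?_, fun hlt => ?_⟩
    · have hlt' := hlt
      simp [Test.Holds, h13, h14] at hlt'
      simp [Running, frameOf, h13, h14, h25, h26, h27, h28, hB', hlt'.le]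
    · have hlt' := hlt
      simp [Test.Holds, h13, h14] at hlt'
      simp [Running, frameOf, h13, h14, h25, h26, h27, h28, hB', hlt']
  · have hB' : ¬ s 22 < 0 := by simpa [Test.Holds, h13] using hB
    simp only [if_neg hB']
    simp [Running, frameOf, h13, h14, h25, h26, h27, h28]

/-- One round of the search. -/
def bodyProg (e : Bool) : Program :=
  .seq (upProg e 30 23)
    (.ite (relTest e 30 21) (.seq (.op (.const 31 0)) (foundProg e))
      (.ite (.lt 24 14) failProg
        (.ite (.lt 21 23) failProg
          (.seq shiftProg
            (.ite (.le 14 22) failProg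
              (.ite (.le 22 13) (.seq (columnProg e) (foundProg e))
                (.seq swapProg shearProg)))))))

/-- A round ends the search, or it goes on with the invariant and a smaller potential. -/
theorem wp_bodyProg {e : Bool} {G : Set ℤ} {n : ℝ} {s : Store} {p q r : ℤ}
    (h : Running s p q r) (hi : (frameOf s).Inv e G n p q r) :
    wp (bodyProg e) (fun s' => Finished G n s' ∨
      ((1 ≤ (frameOf s).N ∧ 0 < (frameOf s).B ∧ (frameOf s).B < 1) ∧
        (∃ p' q' r', Running s' p' q' r' ∧ (frameOf s').Inv e G n p' q' r') ∧
        (0 < (frameOf s').B → (frameOf s').B < 1 → (frameOf s').N * (1 + (frameOf s').B)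
          ≤ 2 / 3 * ((frameOf s).N * (1 + (frameOf s).B))))) s := by
  obtain ⟨h13, h14, h25, h26, h27, h28⟩ := h
  simp only [bodyProg, wp]
  rw [wp_upProg h13 h14 (by norm_num)]
  set s₁ := Function.update s 30 (up e (s 23) : ℝ) with hs₁
  have hr₁ : Running s₁ p q r := by
    simp [Running, hs₁, h13, h14, h25, h26, h27, h28]
  have hf₁ : frameOf s₁ = frameOf s := by simp [frameOf, hs₁]
  have h30 : s₁ 30 = up e (frameOf s).V := by simp [hs₁, frameOf]
  rw [← hf₁] at hi h30 ⊢
  clear_value s₁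
  clear h13 h14 h25 h26 h27 h28 hs₁ hf₁
  obtain ⟨h13, h14, h25, h26, h27, h28⟩ := id hr₁
  refine ⟨fun hb => ⟨trivial, ?_⟩, fun hb => ⟨fun hN => ?_, fun hN => ⟨fun hUV => ?_,
    fun hUV => ?_⟩⟩⟩
  · rw [holds_relTest, h30] at hb
    have hf : frameOf (Op.apply (.const 31 0) s₁) = frameOf s₁ := by
      simp [frameOf, Op.apply]
    refine wp_mono _ (wp_foundProg (G := G) (n := n) (p := p) (q := q) (r := r) (x := 0)
      ?_ ?_ ?_ ?_) fun _ => Or.inl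
    · simp [Running, Op.apply, h13, h14, h25, h26, h27, h28]
    · rw [hf]; exact hi.tracks
    · simp [Op.apply]
    · rw [hf]; exact Frame.lexMin_zero hb
  · rw [holds_relTest, h30] at hb
    exact wp_mono _ (wp_failProg hi.tracks fun x y hxy => Frame.lt_of_not_rel_up hb
      (by simpa [Test.Holds, h14, frameOf] using hN) hxy) fun _ => Or.inl
  · exact wp_mono _ (wp_failProg hi.tracks fun x y hxy =>
      absurd hxy (Frame.not_feas_of_lt hi.le hUV x y)) fun _ => Or.inl
  · rw [holds_relTest, h30] at hb
    have hnorm := Frame.normal_shift hb (not_lt.1 hUV)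
    refine wp_mono _ (wp_shiftProg hr₁ h30) fun s₂ ⟨hr₂, hf₂⟩ => ?_
    have hi₂ := hi.shift (up e (frameOf s₁).V - 1)
    have hN₁ : 1 ≤ (frameOf s₁).N := by simpa [Test.Holds, h14, frameOf] using hN
    have hAN : (frameOf s₁).N = (frameOf s₂).N ∧ (frameOf s₁).B = (frameOf s₂).B := by
      rw [hf₂]; exact ⟨rfl, rfl⟩
    rw [hAN.1] at hN₁
    rw [hAN.1, hAN.2]
    rw [← hf₂] at hi₂ hnorm
    have h13₂ := hr₂.1
    have h14₂ := hr₂.2.1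
    refine ⟨fun hB1 => ?_, fun hB1 => ⟨fun hB0 => ?_, fun hB0 => ?_⟩⟩
    · have hB1' : 1 ≤ (frameOf s₂).B := by simpa [Test.Holds, h14₂, frameOf] using hB1
      exact wp_mono _ (wp_failProg hi₂.tracks fun x y hxy =>
        absurd hxy (hnorm.not_feas hi₂.le_one hB1' x y)) fun _ => Or.inl
    · have hB0' : (frameOf s₂).B ≤ 0 := by simpa [Test.Holds, h13₂, frameOf] using hB0
      refine wp_mono _ (wp_columnProg hr₂ hi₂.pos.ne') fun s₃ ⟨hr₃, hf₃, hx⟩ => ?_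
      refine wp_mono _ (wp_foundProg hr₃ (hf₃ ▸ hi₂.tracks) hx ?_) fun _ => Or.inl
      rw [hf₃]
      exact hnorm.lexMin hi₂.pos hB0' rfl
    · have hB1' : (frameOf s₂).B < 1 := by simpa [Test.Holds, h14₂, frameOf] using hB1
      have hB0' : 0 < (frameOf s₂).B := by simpa [Test.Holds, h13₂, frameOf] using hB0
      refine wp_mono _ (wp_swapProg hr₂ hi₂.pos.ne' hB0'.ne') fun s₃ ⟨hr₃, hf₃⟩ => ?_
      refine wp_mono _ (wp_shearProg hr₃) fun s₄ ⟨hr₄, hf₄⟩ => Or.inr ⟨⟨hN₁, hB0', hB1'⟩, ?_, ?_⟩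
      · have hi₄ := hi₂.next hnorm hB0'
        have h20 : s₃ 20 = 1 / (frameOf s₂).B := congrArg Frame.A hf₃
        refine ⟨_, _, _, hr₄, ?_⟩
        rw [hf₄, hf₃, h20]
        exact hi₄
      · have hf₄' : frameOf s₄ = (frameOf s₂).next := by
          have h20 : s₃ 20 = (frameOf s₂).swap.A := congrArg Frame.A hf₃
          rw [hf₄, hf₃, h20]; rfl
        rw [hf₄']
        exact Frame.next_potential hnorm hB0' hB1' (by linarith)

/-- The search. -/
def searchProg (e : Bool) : Program := .loop (.eq 28 13) (bodyProg e)

theorem writesFrom_bodyProg (e : Bool) : WritesFrom 20 (bodyProg e) := by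
  cases e <;> simp [bodyProg, upProg, foundProg, failProg, columnProg, shiftProg, swapProg,
    shearProg, block, WritesFrom, Op.dest]

theorem Finished.ne_zero {G : Set ℤ} {n : ℝ} {s : Store} (h : Finished G n s) : s 28 ≠ 0 := by
  rcases h with ⟨h, -⟩ | ⟨h, -⟩ <;> rw [h] <;> norm_num

/-- The search ends after as many rounds as the potential allows. -/
theorem exec_searchProg {e : Bool} {G : Set ℤ} {n : ℝ} (m : ℕ) :
    ∀ {s : Store} {p q r : ℤ}, Running s p q r → (frameOf s).Inv e G n p q r →
      (1 ≤ (frameOf s).N → 0 < (frameOf s).B → (frameOf s).B < 1 →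
        (frameOf s).N * (1 + (frameOf s).B) < (3 / 2) ^ m) →
      ∃ t s', Exec (searchProg e) s t s' ∧ t ≤ (m + 1) * (cost (bodyProg e) + 1) + 1 ∧
        Finished G n s' := by
  induction m with
  | zero =>
    intro s p q r h hi hm
    obtain ⟨t, s', he, ht, hs'⟩ := wp_sound _ (wp_bodyProg h hi)
    have h13' : s' 13 = 0 := ((writesFrom_bodyProg e).keeps he (by norm_num)).trans h.1
    have hb : (Test.eq 28 13).Holds s := h.2.2.2.2.2.trans h.1.symm
    rcases hs' with hs' | ⟨⟨hN, hB0, hB1⟩, -⟩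
    · refine ⟨_, s', .loop_true hb he (.loop_false ?_), by omega, hs'⟩
      exact fun h' => hs'.ne_zero (h'.trans h13')
    · have := hm hN hB0 hB1
      nlinarith
  | succ m ih =>
    intro s p q r h hi hm
    obtain ⟨t, s', he, ht, hs'⟩ := wp_sound _ (wp_bodyProg h hi)
    have h13' : s' 13 = 0 := ((writesFrom_bodyProg e).keeps he (by norm_num)).trans h.1
    have hb : (Test.eq 28 13).Holds s := h.2.2.2.2.2.trans h.1.symm
    rcases hs' with hs' | ⟨⟨hN, hB0, hB1⟩, ⟨p', q', r', hr', hi'⟩, hpot⟩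
    · refine ⟨_, s', .loop_true hb he (.loop_false ?_), by nlinarith, hs'⟩
      exact fun h' => hs'.ne_zero (h'.trans h13')
    · have hlt := hm hN hB0 hB1
      obtain ⟨t', s'', he', ht', hs''⟩ := ih hr' hi' fun _ h0 h1 => by
        have := hpot h0 h1
        rw [pow_succ] at hlt
        linarith
      exact ⟨_, s'', .loop_true hb he he', by linarith, hs''⟩

end PixelSweep

/-! ### The gap in pixel units -/

namespace PixelSweep

open RealRAM

/-- A line in pixel units: columns and rows as abscissa and ordinate. -/
noncomputable def PixelGrid.line (P : PixelGrid) (e : Line) : Line :=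
  ⟨e.slope * P.dx / P.dy, (e.slope * P.x₀ + e.intercept - P.y₀) / P.dy⟩

/-- The upper line in pixel units. An absent line is replaced by one above all rows. -/
noncomputable def upperLine (P : PixelGrid) (γ : Gap) : Line :=
  match γ.upper with
  | none => ⟨0, P.rows⟩
  | some e => P.line e

/-- The lower line in pixel units. An absent line is replaced by one below all rows. -/
noncomputable def lowerLine (P : PixelGrid) (γ : Gap) : Line :=
  match γ.lower with
  | none => ⟨0, -1⟩
  | some e => P.line e

theorem upper_iff {e : Bool} {P : PixelGrid} {γ : Gap} {i j : ℕ} (hj : j < P.rows) :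
    (∀ l ∈ γ.upper, if e then P.y₀ + j * P.dy ≤ l.height (P.x₀ + i * P.dx)
      else P.y₀ + j * P.dy < l.height (P.x₀ + i * P.dx)) ↔
      Rel e j ((upperLine P γ).height i) := by
  have hj' : (j : ℝ) < P.rows := by exact_mod_cast hj
  have hdy := P.dy_pos
  unfold upperLine
  cases γ.upper with
  | none => simpa [Line.height] using Rel.of_lt hj'
  | some l =>
    simp only [Option.mem_def, Option.some.injEq, forall_eq']
    refine (rel_scale_iff (e := e) hdy ?_).symm
    simp only [Line.height, PixelGrid.line]
    field_simp
    ring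

theorem lower_iff {e : Bool} {P : PixelGrid} {γ : Gap} {i j : ℕ} :
    (∀ l ∈ γ.lower, if e then l.height (P.x₀ + i * P.dx) ≤ P.y₀ + j * P.dy
      else l.height (P.x₀ + i * P.dx) < P.y₀ + j * P.dy) ↔
      Rel e ((lowerLine P γ).height i) j := by
  have hj' : (-1 : ℝ) < j := by have : (0 : ℝ) ≤ j := j.cast_nonneg; linarith
  have hdy := P.dy_pos
  unfold lowerLine
  cases γ.lower with
  | none => simpa [Line.height] using Rel.of_lt hj'
  | some l =>
    simp only [Option.mem_def, Option.some.injEq, forall_eq']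
    refine (rel_scale_iff (e := e) hdy ?_).symm
    simp only [Line.height, PixelGrid.line]
    field_simp
    ring

/-- The column `i` and the row `j` belong to the grid, and their pixel belongs to the gap. -/
def InGap (e : Bool) (P : PixelGrid) (γ : Gap) (i j : ℕ) : Prop :=
  i < P.cols ∧ j < P.rows ∧ γ.sweep ≤ P.x₀ + i * P.dx ∧
    Rel e j ((upperLine P γ).height i) ∧ Rel e ((lowerLine P γ).height i) j

theorem mem_gap_iff {e : Bool} {P : PixelGrid} {γ : Gap} {q : ℝ × ℝ} :
    q ∈ P.pixels ∩ γ.region e ↔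
      ∃ i j : ℕ, InGap e P γ i j ∧ q = (P.x₀ + i * P.dx, P.y₀ + j * P.dy) := by
  constructor
  · rintro ⟨⟨i, j, hi, hj, rfl⟩, h0, h1, h2⟩
    exact ⟨i, j, ⟨hi, hj, h0, (upper_iff hj).1 h1, lower_iff.1 h2⟩, rfl⟩
  · rintro ⟨i, j, ⟨hi, hj, h0, h1, h2⟩, rfl⟩
    exact ⟨⟨i, j, hi, hj, rfl⟩, h0, (upper_iff hj).2 h1, lower_iff.2 h2⟩

/-- `L` is a column at which the search may start: no earlier column has pixels in the gap, and
from `L` on all those of the conditions `0 ≤ upper`, `lower ≤ rows - 1` and `lower ≤ upper` hold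
that are increasing with the column. -/
structure Start (e : Bool) (P : PixelGrid) (γ : Gap) (L : ℤ) : Prop where
  nonneg : 0 ≤ L
  sweep : ∀ i : ℤ, L ≤ i → γ.sweep ≤ P.x₀ + i * P.dx
  upper : 0 < (upperLine P γ).slope → ∀ i : ℤ, L ≤ i → Rel e 0 ((upperLine P γ).height i)
  lower : (lowerLine P γ).slope < 0 → ∀ i : ℤ, L ≤ i →
    Rel e ((lowerLine P γ).height i) (P.rows - 1)
  between : (lowerLine P γ).slope < (upperLine P γ).slope → ∀ i : ℤ, L ≤ i →
    Rel e ((lowerLine P γ).height i) ((upperLine P γ).height i)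
  le : ∀ i j, InGap e P γ i j → L ≤ i

/-- The columns from `L` on in which the two lines have an integer ordinate between them. -/
def columns (e : Bool) (P : PixelGrid) (γ : Gap) (L : ℤ) : Set ℤ :=
  {i | L ≤ i ∧ ∃ j : ℤ, Rel e j ((upperLine P γ).height i) ∧ Rel e ((lowerLine P γ).height i) j}

theorem Start.mem_columns {e : Bool} {P : PixelGrid} {γ : Gap} {L : ℤ} (hL : Start e P γ L)
    {i j : ℕ} (h : InGap e P γ i j) : (i : ℤ) ∈ columns e P γ L :=
  ⟨hL.le i j h, j, by simpa using h.2.2.2.1, by simpa using h.2.2.2.2⟩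

/-- The lowest row above the lower line in column `i`. -/
noncomputable def lowRow (e : Bool) (P : PixelGrid) (γ : Gap) (i : ℤ) : ℤ :=
  max (up e ((lowerLine P γ).height i)) 0

theorem isLeftmost_of_isLeast {e : Bool} {P : PixelGrid} {γ : Gap} {L i : ℤ}
    (hL : Start e P γ L) (hi : IsLeast (columns e P γ L) i) (hc : i < P.cols)
    (hr : lowRow e P γ i < P.rows) (hu : Rel e (lowRow e P γ i) ((upperLine P γ).height i)) :
    IsLeftmost (P.pixels ∩ γ.region e)
      (P.x₀ + i * P.dx, P.y₀ + lowRow e P γ i * P.dy) := by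
  have hL' := hi.1.1
  have hv : Rel e ((lowerLine P γ).height i) (lowRow e P γ i) :=
    up_le_iff.1 (le_max_left _ _)
  obtain ⟨a, rfl⟩ := Int.eq_ofNat_of_zero_le (hL.nonneg.trans hL')
  obtain ⟨w, hw⟩ := Int.eq_ofNat_of_zero_le (le_max_right (up e ((lowerLine P γ).height (a : ℤ))) 0)
  change lowRow e P γ a = w at hw
  rw [hw] at hr hu hv ⊢
  refine ⟨mem_gap_iff.2 ⟨a, w, ⟨by omega, by omega, hL.sweep a hL', hu, hv⟩, rfl⟩, fun q hq => ?_⟩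
  obtain ⟨i', j', h', rfl⟩ := mem_gap_iff.1 hq
  have : ((a : ℤ) : ℝ) ≤ ((i' : ℤ) : ℝ) := by exact_mod_cast hi.2 (hL.mem_columns h')
  have := mul_le_mul_of_nonneg_right this P.dx_pos.le
  simpa using this

/-- The candidate column meets all conditions if some column does: those that increase with the
column, because the candidate is not before `L`, the others, because it is not after the column
that meets them. -/
theorem check_of_inGap {e : Bool} {P : PixelGrid} {γ : Gap} {L i : ℤ}
    (hL : Start e P γ L) (hi : IsLeast (columns e P γ L) i) {i' j' : ℕ}
    (h' : InGap e P γ i' j') :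
    i < P.cols ∧ lowRow e P γ i < P.rows ∧
      Rel e (lowRow e P γ i) ((upperLine P γ).height i) := by
  obtain ⟨hLi, j, hj1, hj2⟩ := hi.1
  have hii : i ≤ i' := hi.2 (hL.mem_columns h')
  have hii' : (i : ℝ) ≤ i' := by exact_mod_cast hii
  obtain ⟨hc, hr, -, hu, hv⟩ := h'
  have hj0 : (0 : ℝ) ≤ j' := j'.cast_nonneg
  have hr' : (j' : ℝ) ≤ P.rows - 1 := by
    have : ((j' + 1 : ℕ) : ℝ) ≤ P.rows := by exact_mod_cast hr
    push_cast at this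
    linarith
  have hu0 : Rel e 0 ((upperLine P γ).height i) := by
    rcases lt_or_ge 0 (upperLine P γ).slope with h | h
    · exact hL.upper h i hLi
    · refine hu.mono ?_
      simp only [Line.height]
      nlinarith
  have hv1 : Rel e ((lowerLine P γ).height i) (P.rows - 1) := by
    rcases lt_or_ge (lowerLine P γ).slope 0 with h | h
    · exact hL.lower h i hLi
    · refine hv.mono ?_
      simp only [Line.height]
      nlinarith
  refine ⟨by omega, ?_, ?_⟩
  · have h1 : up e ((lowerLine P γ).height i) ≤ (P.rows : ℤ) - 1 :=
      up_le_iff.2 (by simpa using hv1)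
    have := P.rows_pos
    unfold lowRow
    omega
  · unfold lowRow
    rcases max_choice (up e ((lowerLine P γ).height i)) 0 with h | h <;> rw [h]
    · have : (up e ((lowerLine P γ).height i) : ℝ) ≤ j := by exact_mod_cast up_le_iff.2 hj2
      exact hj1.mono (by linarith)
    · simpa using hu0

/-- The frame with origin in column `L`. -/
noncomputable def startFrame (P : PixelGrid) (γ : Gap) (L : ℤ) : Frame :=
  ⟨(upperLine P γ).slope, (upperLine P γ).height L, (lowerLine P γ).slope,
    (lowerLine P γ).height L, P.cols - 1 - L⟩

theorem feas_startFrame {e : Bool} {P : PixelGrid} {γ : Gap} {L x y : ℤ} :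
    (startFrame P γ L).Feas e x y ↔ 0 ≤ x ∧ Rel e y ((upperLine P γ).height (x + L : ℤ)) ∧
      Rel e ((lowerLine P γ).height (x + L : ℤ)) y := by
  simp only [Frame.Feas, startFrame, Line.height]
  push_cast
  ring_nf

theorem Start.inv {e : Bool} {P : PixelGrid} {γ : Gap} {L : ℤ} (hL : Start e P γ L) :
    ((startFrame P γ L).shear (⌈(upperLine P γ).slope⌉ - 1)).Inv e (columns e P γ L)
      (P.cols - 1) 1 0 L := by
  have hr := Frame.reduced (upperLine P γ).slope
  have ht : (startFrame P γ L).Tracks e (columns e P γ L) (P.cols - 1) 1 0 L := by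
    refine ⟨fun x y h => ⟨?_, fun i hi => ?_⟩, fun h i hi => ?_⟩
    · obtain ⟨h0, h1, h2⟩ := feas_startFrame.1 h.1
      have hx : 1 * x + 0 * y + L = x + L := by ring
      rw [hx]
      exact ⟨by linarith, y, h1, h2⟩
    · obtain ⟨h0, j, h1, h2⟩ := hi
      have := h.2 (i - L) j (feas_startFrame.2 ⟨by linarith, by simpa using h1, by simpa using h2⟩)
      rcases this with h | ⟨h, -⟩ <;> linarith
    · obtain ⟨h0, j, h1, h2⟩ := hi
      have := h (i - L) j (feas_startFrame.2 ⟨by linarith, by simpa using h1, by simpa using h2⟩)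
      simp only [startFrame] at this
      push_cast at this
      linarith
  refine ⟨by simpa using ht.shear (⌈(upperLine P γ).slope⌉ - 1), hr.1, hr.2, fun h => ?_⟩
  exact (hL.between (by simpa [Frame.shear, startFrame] using h) L le_rfl).le

/-! ### The complete program

Registers `0` to `12` hold the input until the answer is written, registers `15` to `18` hold the
two lines in pixel units and register `19` the start column. -/

/-- Computes the slope and the intercept in pixel units, in the registers `d` and `d + 1`, of the
line encoded from register `a` on; runs `absent` instead if there is no line. -/
def lineProg (a d : ℕ) (absent : Program) : Program :=
  .ite (.lt 13 a)
    (block [.mul d (a + 1) 4, .div d d 5, .mul (d + 1) (a + 1) 2, .add (d + 1) (d + 1) (a + 2),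
      .sub (d + 1) (d + 1) 3, .div (d + 1) (d + 1) 5])
    absent

/-- Computes the constants and the two lines. -/
def linesProg : Program :=
  .seq (block [.const 13 0, .const 14 1])
    (.seq (lineProg 7 15 (block [.const 15 0, .copy 16 1]))
      (lineProg 10 17 (block [.const 17 0, .const 18 (-1)])))

/-- The memory holds the constants, the input and the two lines. -/
def Prepared (P : PixelGrid) (γ : Gap) (s : Store) : Prop :=
  (s 13 = 0 ∧ s 14 = 1) ∧
    (s 0 = P.cols ∧ s 1 = P.rows ∧ s 2 = P.x₀ ∧ s 3 = P.y₀ ∧ s 4 = P.dx ∧ s 5 = P.dy ∧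
      s 6 = γ.sweep) ∧
    s 15 = (upperLine P γ).slope ∧ s 16 = (upperLine P γ).intercept ∧
    s 17 = (lowerLine P γ).slope ∧ s 18 = (lowerLine P γ).intercept

theorem Prepared.congr {P : PixelGrid} {γ : Gap} {s s' : Store} (h : Prepared P γ s)
    (hs : ∀ k < 19, s' k = s k) : Prepared P γ s' := by
  simpa [Prepared, hs] using h

theorem wp_linesProg (P : PixelGrid) (γ : Gap) :
    wp linesProg (Prepared P γ) (input P γ) := by
  have hdy := P.dy_pos.ne'
  rcases γ with ⟨ℓ, u, v⟩
  cases u <;> cases v <;>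
    simp [linesProg, lineProg, block, wp, Op.Defined, Op.apply, Test.Holds, Prepared, input,
      encodeLine, upperLine, lowerLine, PixelGrid.line, hdy]

/-- Raises register `19` to the first integer from which on `c * i + d` is positive in the sense
of `Rel e`, where the registers `30` and `31` hold `c` and `d`, unless `c ≤ 0`. -/
def raiseProg (e : Bool) : Program :=
  .ite (.lt 13 30)
    (.seq (block [.sub 32 13 31, .div 32 32 30]) (.seq (upProg e 32 32)
      (.ite (.lt 19 32) (.op (.copy 19 32)) .skip)))
    .skip

theorem writesFrom_raiseProg (e : Bool) : WritesFrom 19 (raiseProg e) := by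
  cases e <;> simp [raiseProg, upProg, block, WritesFrom, Op.dest]

theorem wp_raiseProg {e : Bool} {s : Store} {L : ℤ} (h13 : s 13 = 0) (h14 : s 14 = 1)
    (hL : s 19 = L) :
    wp (raiseProg e) (fun s' => ∃ L' : ℤ, s' 19 = L' ∧ L ≤ L' ∧
      (0 < s 30 → ∀ i : ℤ, L' ≤ i → Rel e 0 (s 30 * i + s 31)) ∧
      ∀ i : ℤ, L ≤ i → Rel e 0 (s 30 * i + s 31) → L' ≤ i) s := by
  simp only [raiseProg, block, wp, Op.Defined, Op.apply, true_and]
  refine ⟨fun hc => ?_, fun hc => ?_⟩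
  · have hc' : 0 < s 30 := by simpa [Test.Holds, h13] using hc
    refine ⟨by simpa using hc'.ne', ?_⟩
    rw [wp_upProg (by simpa using h13) (by simpa using h14) (by norm_num)]
    have row : ∀ i : ℤ, up e ((0 - s 31) / s 30) ≤ i ↔ Rel e 0 (s 30 * i + s 31) := fun i => by
      rw [up_le_iff]
      exact rel_scale_iff hc' (by field_simp; ring)
    have hv : ((0 : ℝ) - s 31) / s 30 = -s 31 / s 30 := by ring
    rw [hv] at row
    refine ⟨fun hlt => ?_, fun hlt => ?_⟩
    · have hlt' : L < up e (-s 31 / s 30) := by simpa [Test.Holds, h13, hL] using hlt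
      exact ⟨up e (-s 31 / s 30), by simp [h13], hlt'.le, fun _ i => (row i).1,
        fun i _ => (row i).2⟩
    · have hlt' : up e (-s 31 / s 30) ≤ L := by simpa [Test.Holds, h13, hL] using hlt
      exact ⟨L, by simp [hL], le_rfl, fun _ i hi => (row i).1 (hlt'.trans hi), fun i hi _ => hi⟩
  · have hc' : ¬ 0 < s 30 := by simpa [Test.Holds, h13] using hc
    exact ⟨L, hL, le_rfl, fun h => absurd h hc', fun i hi _ => hi⟩

/-- Computes the first column on or to the right of the sweepline. -/
def sweepProg : Program :=
  .seq (block [.sub 19 2 6, .div 19 19 4, .floor 19 19, .sub 19 13 19])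
    (.ite (.lt 19 13) (.op (.copy 19 13)) .skip)

/-- Computes the start column. -/
def startProg (e : Bool) : Program :=
  .seq sweepProg
    (.seq (.seq (block [.copy 30 15, .copy 31 16]) (raiseProg e))
      (.seq (.seq (block [.sub 30 13 17, .sub 31 1 14, .sub 31 31 18]) (raiseProg e))
        (.seq (block [.sub 30 15 17, .sub 31 16 18]) (raiseProg e))))

/-- The start column before the conditions on the lines are taken into account. -/
theorem sweep_iff {P : PixelGrid} {γ : Gap} {i : ℤ} :
    max (-⌊(P.x₀ - γ.sweep) / P.dx⌋) 0 ≤ i ↔ 0 ≤ i ∧ γ.sweep ≤ P.x₀ + i * P.dx := by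
  rw [max_le_iff, and_comm, neg_le, Int.le_floor, le_div_iff₀ P.dx_pos]
  push_cast
  constructor <;> rintro ⟨h, h'⟩ <;> exact ⟨h, by linarith⟩

theorem wp_startProg {e : Bool} {P : PixelGrid} {γ : Gap} {s : Store} (h : Prepared P γ s) :
    wp (startProg e) (fun s' => Prepared P γ s' ∧ ∃ L : ℤ, s' 19 = L ∧ Start e P γ L) s := by
  have hdx := P.dx_pos.ne'
  have h' := h
  obtain ⟨⟨h13, h14⟩, ⟨h0, h1, h2, h3, h4, h5, h6⟩, h15, h16, h17, h18⟩ := h'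
  have hfirst : wp sweepProg (fun s' => Prepared P γ s' ∧
      s' 19 = (max (-⌊(P.x₀ - γ.sweep) / P.dx⌋) 0 : ℤ)) s := by
    refine wp_mono _ (wp_keeps (n := 19) _ (by simp [sweepProg, block, WritesFrom, Op.dest])
      (Q := fun s' => s' 19 = (max (-⌊(P.x₀ - γ.sweep) / P.dx⌋) 0 : ℤ)) ?_)
      fun s' hs' => ⟨h.congr hs'.2, hs'.1⟩
    simp only [sweepProg, block, wp, Op.Defined, Op.apply, true_and]
    refine ⟨by simpa [h4] using hdx, fun hb => ?_, fun hb => ?_⟩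
    · have hb' : -(⌊(P.x₀ - γ.sweep) / P.dx⌋ : ℝ) < 0 := by
        simpa [Test.Holds, h13, h2, h4, h6] using hb
      simp only [Int.cast_max, Int.cast_neg, Int.cast_zero]
      rw [max_eq_right hb'.le]
      simpa using h13
    · have hb' : 0 ≤ -(⌊(P.x₀ - γ.sweep) / P.dx⌋ : ℝ) := by
        simpa [Test.Holds, h13, h2, h4, h6] using hb
      simp only [Int.cast_max, Int.cast_neg, Int.cast_zero]
      rw [max_eq_left hb']
      simp [h13, h2, h4, h6]
  have hraise : ∀ (l : List Op) (c d : ℝ) (s : Store) (L : ℤ), Prepared P γ s → s 19 = L →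
      WritesFrom 19 (block l) →
      wp (block l) (fun s' => s' 19 = s 19 ∧ s' 30 = c ∧ s' 31 = d) s →
      wp (.seq (block l) (raiseProg e)) (fun s' => Prepared P γ s' ∧ ∃ L' : ℤ, s' 19 = L' ∧
        L ≤ L' ∧ (0 < c → ∀ i : ℤ, L' ≤ i → Rel e 0 (c * i + d)) ∧
        ∀ i : ℤ, L ≤ i → Rel e 0 (c * i + d) → L' ≤ i) s := by
    intro l c d s L hp hL hw hl
    refine wp_seq (wp_keeps _ hw hl) fun s₁ ⟨⟨h19, hc, hd⟩, hk⟩ => ?_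
    have hp₁ := hp.congr hk
    have := wp_raiseProg (e := e) hp₁.1.1 hp₁.1.2 (h19.trans hL)
    rw [hc, hd] at this
    exact wp_mono _ (wp_keeps _ (writesFrom_raiseProg e) this) fun s₂ h₂ =>
      ⟨hp₁.congr h₂.2, h₂.1⟩
  set u := upperLine P γ with hu
  set v := lowerLine P γ with hv
  refine wp_seq hfirst fun s₀ ⟨hp₀, hL₀⟩ => ?_
  set L₀ := max (-⌊(P.x₀ - γ.sweep) / P.dx⌋) 0 with hL₀'
  refine wp_seq (hraise _ u.slope u.intercept s₀ L₀ hp₀ hL₀ (by simp [block, WritesFrom, Op.dest])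
    (by simp [block, wp, Op.Defined, Op.apply, hp₀.2.2.1, hp₀.2.2.2.1, hu]))
    fun s₁ ⟨hp₁, L₁, hL₁, hle₁, hin₁, hout₁⟩ => ?_
  refine wp_seq (hraise _ (-v.slope) (P.rows - 1 - v.intercept) s₁ L₁ hp₁ hL₁
    (by simp [block, WritesFrom, Op.dest]) (by
      simp [block, wp, Op.Defined, Op.apply, hp₁.1.1, hp₁.1.2, hp₁.2.1.2.1, hp₁.2.2.2.2.1,
        hp₁.2.2.2.2.2, hv]))
    fun s₂ ⟨hp₂, L₂, hL₂, hle₂, hin₂, hout₂⟩ => ?_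
  refine wp_mono _ (hraise _ (u.slope - v.slope) (u.intercept - v.intercept) s₂ L₂ hp₂ hL₂
    (by simp [block, WritesFrom, Op.dest]) (by
      simp [block, wp, Op.Defined, Op.apply, hp₂.2.2.1, hp₂.2.2.2.1, hp₂.2.2.2.2.1,
        hp₂.2.2.2.2.2, hu, hv]))
    fun s₃ ⟨hp₃, L₃, hL₃, hle₃, hin₃, hout₃⟩ => ?_
  refine ⟨hp₃, L₃, hL₃, ?_, fun i hi => ?_, fun hs i hi => ?_, fun hs i hi => ?_,
    fun hs i hi => ?_, fun i j hij => ?_⟩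
  · exact (le_max_right _ _).trans (hle₁.trans (hle₂.trans hle₃))
  · exact (sweep_iff.1 (hle₁.trans (hle₂.trans (hle₃.trans hi)))).2
  · exact hin₁ hs i (hle₂.trans (hle₃.trans hi))
  · refine (hin₂ (neg_pos.2 hs) i (hle₃.trans hi)).mono ?_
    simp only [Line.height]; linarith
  · refine (hin₃ (sub_pos.2 hs) i hi).mono ?_
    simp only [Line.height]; linarith
  · obtain ⟨-, hr, hsw, hup, hlo⟩ := hij
    have hj0 : (0 : ℝ) ≤ j := j.cast_nonneg
    have hr' : (j : ℝ) ≤ P.rows - 1 := by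
      have : ((j + 1 : ℕ) : ℝ) ≤ P.rows := by exact_mod_cast hr
      push_cast at this
      linarith
    simp only [Line.height] at hup hlo
    refine hout₃ i (hout₂ i (hout₁ i (sweep_iff.2 ⟨by omega, by simpa using hsw⟩) ?_) ?_) ?_
    · exact hup.mono (by push_cast; linarith)
    · exact hlo.mono (by push_cast; linarith)
    · exact hup.mono (by push_cast; linarith [hlo.le])

/-- Initializes the search. -/
def initProg : Program :=
  .seq (block [.copy 20 15, .mul 21 15 19, .add 21 21 16, .copy 22 17, .mul 23 17 19,
      .add 23 23 18, .sub 24 0 14, .sub 24 24 19, .const 25 1, .const 26 0, .copy 27 19,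
      .const 28 0])
    shearProg

theorem wp_initProg {P : PixelGrid} {γ : Gap} {s : Store} {L : ℤ} (h : Prepared P γ s)
    (hL : s 19 = L) :
    wp initProg (fun s' => Prepared P γ s' ∧ Running s' 1 0 L ∧
      frameOf s' = (startFrame P γ L).shear (⌈(upperLine P γ).slope⌉ - 1)) s := by
  refine wp_mono _ (wp_keeps (n := 19) _ (by
    simp [initProg, shearProg, block, WritesFrom, Op.dest]) (Q := fun s' => Running s' 1 0 L ∧
      frameOf s' = (startFrame P γ L).shear (⌈(upperLine P γ).slope⌉ - 1)) ?_)
    fun s' hs' => ⟨h.congr hs'.2, hs'.1⟩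
  obtain ⟨⟨h13, h14⟩, ⟨h0, h1, h2, h3, h4, h5, h6⟩, h15, h16, h17, h18⟩ := h
  have hb : wp (block [.copy 20 15, .mul 21 15 19, .add 21 21 16, .copy 22 17, .mul 23 17 19,
      .add 23 23 18, .sub 24 0 14, .sub 24 24 19, .const 25 1, .const 26 0, .copy 27 19,
      .const 28 0]) (fun s' => Running s' 1 0 L ∧ frameOf s' = startFrame P γ L) s := by
    simp [block, wp, Op.Defined, Op.apply, Running, frameOf, startFrame, Line.height, h13, h14,
      h0, h15, h16, h17, h18, hL]
  refine wp_seq hb fun s₁ ⟨hr₁, hf₁⟩ => ?_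
  refine wp_mono _ (wp_shearProg hr₁) fun s₂ ⟨hr₂, hf₂⟩ => ?_
  have h20 : s₁ 20 = (upperLine P γ).slope := congrArg Frame.A hf₁
  rw [hf₁, h20] at hf₂
  exact ⟨by simpa using hr₂, hf₂⟩

/-- Reports that there is no pixel. -/
def emptyProg : Program := .op (.const 0 0)

/-- Computes the lowest row above the lower line and the height of the upper line in the candidate
column. -/
def rowProg (e : Bool) : Program :=
  .seq (block [.mul 30 17 29, .add 30 30 18]) (.seq (upProg e 30 30)
    (.seq (.ite (.lt 30 13) (.op (.copy 30 13)) .skip) (block [.mul 31 15 29, .add 31 31 16])))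

/-- Checks the candidate column and writes the answer. -/
def answerProg (e : Bool) : Program :=
  .ite (.eq 28 14)
    (.seq (rowProg e)
      (.ite (.lt 29 0)
        (.ite (.lt 30 1)
          (.ite (relTest e 30 31)
            (block [.copy 0 14, .mul 31 29 4, .add 1 2 31, .mul 31 30 5, .add 2 3 31])
            emptyProg)
          emptyProg)
        emptyProg))
    emptyProg

theorem wp_emptyProg {A : Set (ℝ × ℝ)} {s : Store} (h : A = ∅) :
    wp emptyProg (fun s' => Answers s' A) s :=
  ⟨trivial, Or.inr ⟨by simp [Op.apply], h⟩⟩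

theorem wp_answerProg {e : Bool} {P : PixelGrid} {γ : Gap} {s : Store} {L : ℤ}
    (h : Prepared P γ s) (hL : Start e P γ L)
    (hs : Finished (columns e P γ L) (P.cols - 1) s) :
    wp (answerProg e) (fun s' => Answers s' (P.pixels ∩ γ.region e)) s := by
  obtain ⟨⟨h13, h14⟩, ⟨h0, h1, h2, h3, h4, h5, h6⟩, h15, h16, h17, h18⟩ := h
  refine ⟨fun hb => ?_, fun hb => ?_⟩
  · rcases hs with ⟨-, i, h29, hi⟩ | ⟨h28, -⟩
    swap
    · have : s 28 = s 14 := hb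
      rw [h28, h14] at this
      norm_num at this
    have hfail : ¬ (i < P.cols ∧ lowRow e P γ i < P.rows ∧
        Rel e (lowRow e P γ i) ((upperLine P γ).height i)) → P.pixels ∩ γ.region e = ∅ := by
      intro hn
      refine Set.eq_empty_iff_forall_notMem.2 fun q hq => hn ?_
      obtain ⟨i', j', h', -⟩ := mem_gap_iff.1 hq
      exact check_of_inGap hL hi h'
    have hrow : wp (rowProg e) (fun s' => s' 30 = lowRow e P γ i ∧
        s' 31 = (upperLine P γ).height i) s := by
      simp only [rowProg, block, wp, Op.Defined, Op.apply, true_and]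
      rw [wp_upProg (by simpa using h13) (by simpa using h14) (by norm_num)]
      refine ⟨fun hb => ?_, fun hb => ?_⟩
      · have hb' : up e ((lowerLine P γ).height i) < 0 := by
          simpa [Test.Holds, h13, h17, h18, h29, Line.height] using hb
        rw [lowRow, max_eq_right hb'.le]
        simp [Line.height, h13, h15, h16, h29]
      · have hb' : 0 ≤ up e ((lowerLine P γ).height i) := by
          simpa [Test.Holds, h13, h17, h18, h29, Line.height] using hb
        rw [lowRow, max_eq_left hb']
        simp [Line.height, h15, h16, h17, h18, h29]
    refine wp_seq (wp_keeps (n := 30) _ (by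
      cases e <;> simp [rowProg, upProg, block, WritesFrom, Op.dest]) hrow)
      fun s' ⟨⟨h30, h31⟩, hk⟩ => ?_
    have hlt0 : (Test.lt 29 0).Holds s' ↔ i < P.cols := by
      simp only [Test.Holds, hk 29 (by norm_num), hk 0 (by norm_num), h29, h0]
      exact_mod_cast Iff.rfl
    have hlt1 : (Test.lt 30 1).Holds s' ↔ lowRow e P γ i < P.rows := by
      simp only [Test.Holds, h30, hk 1 (by norm_num), h1]
      exact_mod_cast Iff.rfl
    have hrel : (relTest e 30 31).Holds s' ↔
        Rel e (lowRow e P γ i) ((upperLine P γ).height i) := by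
      rw [holds_relTest, h30, h31]
    refine ⟨fun c1 => ⟨fun c2 => ⟨fun c3 => ?_, fun c3 => ?_⟩, fun c2 => ?_⟩, fun c1 => ?_⟩
    · rw [hlt0] at c1
      rw [hlt1] at c2
      rw [hrel] at c3
      have := isLeftmost_of_isLeast hL hi c1 c2 c3
      simp only [block, wp, Op.Defined, Op.apply, true_and]
      refine Or.inl ⟨by simp [hk, h14], ?_⟩
      simpa [hk, h30, h2, h3, h4, h5, h29] using this
    · exact wp_emptyProg (hfail fun hh => c3 (hrel.2 hh.2.2))
    · exact wp_emptyProg (hfail fun hh => c2 (hlt1.2 hh.2.1))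
    · exact wp_emptyProg (hfail fun hh => c1 (hlt0.2 hh.1))
  · rcases hs with ⟨h28, -⟩ | ⟨-, hn⟩
    · exact absurd (h28.trans h14.symm) hb
    · refine wp_emptyProg (Set.eq_empty_iff_forall_notMem.2 fun q hq => ?_)
      obtain ⟨i, j, hij, -⟩ := mem_gap_iff.1 hq
      have h1 := hn i (hL.mem_columns hij)
      have h2 : ((i + 1 : ℕ) : ℝ) ≤ P.cols := by exact_mod_cast hij.1
      push_cast at h1 h2
      linarith

/-- Everything before the search. -/
def setupProg (e : Bool) : Program := .seq linesProg (.seq (startProg e) initProg)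

theorem wp_setupProg (e : Bool) (P : PixelGrid) (γ : Gap) :
    wp (setupProg e) (fun s => ∃ L : ℤ, Start e P γ L ∧ Prepared P γ s ∧ Running s 1 0 L ∧
      frameOf s = (startFrame P γ L).shear (⌈(upperLine P γ).slope⌉ - 1)) (input P γ) :=
  wp_seq (wp_linesProg P γ) fun _ h₁ => wp_seq (wp_startProg h₁)
    fun _ ⟨h₂, L, hL, hS⟩ => wp_mono _ (wp_initProg h₂ hL) fun _ h₃ => ⟨L, hS, h₃⟩

/-- The complete program. -/
def gapProg (e : Bool) : Program := .seq (setupProg e) (.seq (searchProg e) (answerProg e))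

theorem exists_exec (e : Bool) (P : PixelGrid) (γ : Gap) :
    ∃ t s, Exec (gapProg e) (input P γ) t s ∧
      t ≤ cost (setupProg e) + ((2 * (Nat.log 2 P.size + 2) + 1) * (cost (bodyProg e) + 1) + 1)
        + cost (answerProg e) ∧ Answers s (P.pixels ∩ γ.region e) := by
  obtain ⟨t₁, s₁, he₁, ht₁, L, hL, hp, hr, hf⟩ := wp_sound _ (wp_setupProg e P γ)
  have hi := hL.inv
  rw [← hf] at hi
  obtain ⟨t₂, s₂, he₂, ht₂, hs₂⟩ := exec_searchProg (2 * (Nat.log 2 P.size + 2)) hr hi (by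
    intro hN hB0 hB1
    -- `N < p`, and `p < 2 ^ (log₂ p + 1)`, while `2 ≤ (3 / 2) ^ 2`.
    have hNc : (frameOf s₁).N < P.size := by
      rw [hf]
      simp only [Frame.shear, startFrame]
      have h1 : (P.cols : ℝ) ≤ P.size := by
        exact_mod_cast Nat.le_mul_of_pos_right _ P.rows_pos
      have h2 : (0 : ℝ) ≤ L := by exact_mod_cast hL.nonneg
      linarith
    have hlog : (P.size : ℝ) < 2 ^ (Nat.log 2 P.size + 1) := by
      exact_mod_cast Nat.lt_pow_succ_log_self (by norm_num) P.size
    calc (frameOf s₁).N * (1 + (frameOf s₁).B) ≤ (frameOf s₁).N * 2 :=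
          mul_le_mul_of_nonneg_left (by linarith) (by linarith)
      _ < 2 ^ (Nat.log 2 P.size + 2) := by rw [pow_succ]; linarith
      _ ≤ ((3 / 2) ^ 2) ^ (Nat.log 2 P.size + 2) :=
          pow_le_pow_left₀ (by norm_num) (by norm_num) _
      _ = _ := (pow_mul _ _ _).symm)
  have hp₂ := hp.congr fun k hk =>
    WritesFrom.keeps he₂ (writesFrom_bodyProg e) (hk.trans (by norm_num))
  obtain ⟨t₃, s₃, he₃, ht₃, hs₃⟩ := wp_sound _ (wp_answerProg hp₂ hL hs₂)
  exact ⟨_, s₃, .seq he₁ (.seq he₂ he₃), by omega, hs₃⟩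

theorem natLog_two_le {p : ℕ} (hp : 0 < p) : (Nat.log 2 p : ℝ) ≤ 2 * Real.log p := by
  have h1 : ((2 : ℝ) ^ Nat.log 2 p) ≤ p := by exact_mod_cast Nat.pow_log_le_self 2 hp.ne'
  have h2 := Real.log_le_log (by positivity) h1
  rw [Real.log_pow] at h2
  have h3 := Real.log_two_gt_d9
  have h4 : (0 : ℝ) ≤ Nat.log 2 p := Nat.cast_nonneg _
  nlinarith

end PixelSweep

theorem mainTheorem5 (edges : Bool) :
    ∃ (prog : RealRAM.Program) (C : ℝ),
      ∀ (P : PixelSweep.PixelGrid) (γ : PixelSweep.Gap),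
        ∃ (t : ℕ) (s : RealRAM.Store),
          RealRAM.Exec prog (PixelSweep.input P γ) t s ∧
          (t : ℝ) ≤ C * (1 + Real.log P.size) ∧
          PixelSweep.Answers s (P.pixels ∩ γ.region edges) := by
  set a := RealRAM.cost (PixelSweep.setupProg edges)
  set b := RealRAM.cost (PixelSweep.bodyProg edges)
  set c := RealRAM.cost (PixelSweep.answerProg edges)
  refine ⟨PixelSweep.gapProg edges, (a + (5 * (b + 1) + 1) + c : ℕ), fun P γ => ?_⟩
  obtain ⟨t, s, he, ht, hs⟩ := PixelSweep.exists_exec edges P γ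
  refine ⟨t, s, he, ?_, hs⟩
  have hp : 0 < P.size := Nat.mul_pos P.cols_pos P.rows_pos
  have hlog := PixelSweep.natLog_two_le hp
  have h0 : 0 ≤ Real.log P.size := Real.log_natCast_nonneg _
  have ht' : (t : ℝ) ≤ a + ((2 * (Nat.log 2 P.size + 2) + 1) * (b + 1) + 1) + c := by
    exact_mod_cast ht
  -- `2 * (k + 2) + 1 = 5 + 2 * k`, and `k = Nat.log 2 p` is at most `2 * log p`.
  refine ht'.trans ?_
  push_cast
  have hb : (0 : ℝ) ≤ b + 1 := by positivity
  have := mul_le_mul_of_nonneg_right hlog hb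
  have ha0 : 0 ≤ (a : ℝ) * Real.log P.size := by positivity
  have hc0 : 0 ≤ (c : ℝ) * Real.log P.size := by positivity
  have hb0 : 0 ≤ (b + 1 : ℝ) * Real.log P.size := by positivity
  nlinarith
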